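/- Graphs are simple and undirected, regarded as structures with the adjacency relation $E$ and equality; $\log$ is the logarithm to base $2$. For a first-order formula $\Phi$ over the connectives $\neg,\wedge,\vee$, the set $\mathrm{Nest}(\Phi)$ of sequences of nested quantifiers is defined by: $\mathrm{Nest}(\Phi)$ consists of the empty word if $\Phi$ is atomic; $\mathrm{Nest}(\neg\Phi)$ is obtained from $\mathrm{Nest}(\Phi)$ by exchanging $\exists$ and $\forall$ in all words; $\mathrm{Nest}(\Phi\wedge\Psi)=\mathrm{Nest}(\Phi\vee\Psi)=\mathrm{Nest}(\Phi)\cup\mathrm{Nest}(\Psi)$; and $\mathrm{Nest}(\exists x\,\Phi)$, $\mathrm{Nest}(\forall x\,\Phi)$ are obtained from $\mathrm{Nest}(\Phi)$ by prefixing all words with $\exists$, respectively $\forall$. The quantifier rank of $\Phi$ is the maximum length of a word in $\mathrm{Nest}(\Phi)$, and its alternation number is the maximum number of occurrences of $\exists\forall$ and $\forall\exists$ in a word of $\mathrm{Nest}(\Phi)$. A closed formula $\Phi$ defines $G$ (up to isomorphism) if $\Phi$ is true on $G$ and false on every graph (finite or infinite) not isomorphic to $G$. Let $D(G)$ denote the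 minimum quantifier rank of a closed formula defining $G$. **Theorem.** Let $d\ge 2$ be an integer, and put $c_d=\dfrac{d+1}{\log(3/2)}+1$. (1) If $G$ is a finite tree on $n$ vertices with maximum vertex degree $d$, then there is a closed first-order formula over the vocabulary $\{E,=\}$ that defines $G$, has alternation number at most $2$, and has quantifier rank strictly less than $c_d\log n+d+2$. (2) Consequently, $D(G)=O(\log n)$ for trees of bounded degree: there is a constant $C$, depending only on $d$, such that $D(G)\le C\log n$ for every finite tree $G$ on $n\ge 2$ vertices with maximum vertex degree at most $d$. -/

import Mathlib

universe u

namespace GraphDefinability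

open FirstOrder FirstOrder.Language

/-- The alphabet `{∃, ∀}`. -/
inductive Quantifier : Type
  | ex
  | all
  deriving DecidableEq

/-- Exchange of `∃` and `∀`. -/
def Quantifier.dual : Quantifier → Quantifier
  | .ex => .all
  | .all => .ex

/-- The set of sequences of nested quantifiers of a first-order formula. Mathlib's primitive
connectives are `⊥`, `→`, `∀`; here `φ → ψ` is read as `¬φ ∨ ψ`, and negation dualizes the
sequences. For the derived connectives, `¬φ` is `φ → ⊥`, `φ ∨ ψ` is `¬φ → ψ`, `φ ∧ ψ` is
`¬(φ → ¬ψ)` and `∃ x, φ` is `¬ ∀ x, ¬φ`, so that `∧` and `∨` yield unions and `∃` prefixes the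
letter `∃`, except that the constant `⊥` may contribute further sequences consisting of an initial
part of other ones, which change neither the maximal length nor the maximal number of
alternations. -/
def nest {L : Language} {α : Type*} : {n : ℕ} → L.BoundedFormula α n → Finset (List Quantifier)
  | _, .falsum => {[]}
  | _, .equal _ _ => {[]}
  | _, .rel _ _ => {[]}
  | _, .imp φ ψ => (nest φ).image (List.map Quantifier.dual) ∪ nest ψ
  | _, .all φ => (nest φ).image (List.cons Quantifier.all)

/-- The number of occurrences of `∃∀` and `∀∃` in a sequence of quantifiers. -/
def alternations : List Quantifier → ℕ
  | [] => 0
  | [_] => 0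
  | a :: b :: s => (if a = b then 0 else 1) + alternations (b :: s)

/-- The quantifier rank: the maximum length of a sequence of nested quantifiers. -/
def quantifierRank {L : Language} {α : Type*} {n : ℕ} (φ : L.BoundedFormula α n) : ℕ :=
  (nest φ).sup List.length

/-- The alternation number: the maximum number of alternations in a sequence of nested
quantifiers. -/
def alternationNumber {L : Language} {α : Type*} {n : ℕ} (φ : L.BoundedFormula α n) : ℕ :=
  (nest φ).sup alternations

/-- The closed first-order formula `φ` over the vocabulary `{E, =}` is true on the graph `G`. -/
def Holds {V : Type*} (φ : Language.graph.Sentence) (G : SimpleGraph V) : Prop :=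
  @Sentence.Realize Language.graph V G.structure φ

/-- `φ` distinguishes `G` from `G'`. -/
def Distinguishes {V V' : Type*} (φ : Language.graph.Sentence) (G : SimpleGraph V)
    (G' : SimpleGraph V') : Prop :=
  Holds φ G ∧ ¬ Holds φ G'

/-- `φ` defines `G` up to isomorphism: it is true on `G` and distinguishes `G` from every
non-isomorphic graph `G'` (finite or infinite). -/
def Defines {V : Type u} (φ : Language.graph.Sentence) (G : SimpleGraph V) : Prop :=
  Holds φ G ∧ ∀ (V' : Type u) (G' : SimpleGraph V'), IsEmpty (G ≃g G') → Distinguishes φ G G'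

/-- `D(G)`: the minimum quantifier rank of a closed formula defining `G`
(`⊤` if there is no such formula). -/
noncomputable def definingRank {V : Type u} (G : SimpleGraph V) : ℕ∞ :=
  ⨅ (φ : Language.graph.Sentence) (_ : Defines φ G), (quantifierRank φ : ℕ∞)

end GraphDefinability

/-!
A map `f` from the vertices of a tree `G` to the vertices of a graph `G'` is a *covering* if it maps
the neighbours of each vertex `v` bijectively onto the neighbours of `f v`. If `G` is finite and
`G'` is connected, then such a map is an isomorphism (`nonempty_iso_of_locallyBijective`): all
fibres have the same number `m` of elements, so `m` divides both the number of vertices and the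
number of edges of `G`, and these differ by one. Hence `G` is defined by the conjunction of two
sentences, one saying that any two vertices are joined by a walk of length at most `2 ^ k`, where
`2 ^ k` exceeds the number of vertices of `G`, the other saying that there is a covering from `G`.

The first is an `∀∀∃*` sentence of rank `k + 2`, as a walk can be described by repeatedly guessing
its midpoint (`walkFormula`). For the second, the values of the covering are guessed along a
recursive decomposition of the tree by centroids (`exists_centroid`): the values at a centroid `v`
and its neighbours are guessed, local bijectivity at `v` is checked with one universal quantifier,
and the components of `G - v` are treated independently of each other
(`definable_exists_locallyBijective`). Each level costs at most `d + 1` quantifiers and halves the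
size of the components, and no universal quantifier precedes an existential one.
-/

namespace GraphDefinability

open FirstOrder FirstOrder.Language

/-! ### Coverings and centroids of trees -/

/-- A vertex map is locally bijective at `v` if it maps the neighbours of `v` bijectively onto the
neighbours of the image of `v`. A map with this property at all vertices is a covering of graphs. -/
def LocallyBijectiveAt {V V' : Type*} (G : SimpleGraph V) (G' : SimpleGraph V') (f : V → V')
    (v : V) : Prop :=
  Set.BijOn f (G.neighborSet v) (G'.neighborSet (f v))

section Graphs

variable {V : Type*} {G : SimpleGraph V}

theorem locallyBijectiveAt_id (v : V) : LocallyBijectiveAt G G id v :=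
  Set.bijOn_id _

/-- Local bijectivity at `v` depends only on the values at `v` and its neighbours. -/
theorem LocallyBijectiveAt.congr {V' : Type*} {G' : SimpleGraph V'} {f g : V → V'} {v : V}
    (h : LocallyBijectiveAt G G' f v) (hv : f v = g v) (hN : ∀ w, G.Adj v w → f w = g w) :
    LocallyBijectiveAt G G' g v := by
  unfold LocallyBijectiveAt at *
  rw [← hv]
  exact Set.BijOn.congr h hN

/-- In a covering, the fibre over a vertex injects into the fibre over any neighbour: every vertex
over `a` has a neighbour over `b`, and no two have the same one. -/
theorem card_fiber_le_of_adj [Fintype V] {V' : Type*} [DecidableEq V'] {G' : SimpleGraph V'}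
    {f : V → V'} (hf : ∀ v, LocallyBijectiveAt G G' f v) {a b : V'} (hab : G'.Adj a b) :
    (Finset.univ.filter (f · = a)).card ≤ (Finset.univ.filter (f · = b)).card := by
  have key : ∀ x, f x = a → ∃ y, G.Adj x y ∧ f y = b := fun x hx =>
    (hf x).surjOn (show b ∈ G'.neighborSet (f x) from hx ▸ hab)
  choose! s hs using key
  refine Finset.card_le_card_of_injOn s (fun x hx => ?_) (fun x hx y hy hxy => ?_)
  · simp only [Finset.coe_filter, Finset.mem_univ, true_and, Set.mem_ofPred_eq] at hx ⊢
    exact (hs x hx).2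
  · simp only [Finset.coe_filter, Finset.mem_univ, true_and, Set.mem_ofPred_eq] at hx hy
    exact (hf (s x)).injOn (hs x hx).1.symm (hxy ▸ (hs y hy).1.symm) (hx.trans hy.symm)

/-- A covering of a connected graph by a finite tree is an isomorphism. -/
theorem nonempty_iso_of_locallyBijective [Fintype V] (hG : G.IsTree) {V' : Type*}
    {G' : SimpleGraph V'} (hG' : G'.Preconnected) {f : V → V'}
    (hf : ∀ v, LocallyBijectiveAt G G' f v) : Nonempty (G ≃g G') := by
  classical
  obtain ⟨x₀⟩ := hG.connected.nonempty
  have hsurj : Function.Surjective f := by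
    intro b
    obtain ⟨p⟩ := hG' (f x₀) b
    have : ∀ {a b : V'} (_ : G'.Walk a b), a ∈ Set.range f → b ∈ Set.range f := by
      intro a b p
      induction p with
      | nil => exact id
      | cons h _ ih =>
        rintro ⟨x, rfl⟩
        obtain ⟨y, -, hy⟩ := (hf x).surjOn h
        exact ih ⟨y, hy⟩
    exact this p ⟨x₀, rfl⟩
  have : Fintype V' := Fintype.ofSurjective f hsurj
  set m := (Finset.univ.filter (f · = f x₀)).card with hm
  have hfib : ∀ b, (Finset.univ.filter (f · = b)).card = m := by
    intro b
    obtain ⟨p⟩ := hG' b (f x₀)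
    rw [hm]
    generalize f x₀ = a at p
    induction p with
    | nil => rfl
    | cons h _ ih =>
      exact (le_antisymm (card_fiber_le_of_adj hf h) (card_fiber_le_of_adj hf h.symm)).trans ih
  have hcard : Fintype.card V = m * Fintype.card V' := by
    rw [← Finset.card_univ, Finset.card_eq_sum_card_fiberwise (f := f) (t := Finset.univ)
      (fun _ _ => Finset.mem_coe.2 (Finset.mem_univ _)), Finset.sum_congr rfl (fun b _ => hfib b)]
    simp [mul_comm]
  have hdeg : ∀ x, G.degree x = G'.degree (f x) := fun x => by
    rw [← SimpleGraph.card_neighborSet_eq_degree, ← SimpleGraph.card_neighborSet_eq_degree]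
    exact Fintype.card_congr (Set.BijOn.equiv f (hf x))
  have hedge : G.edgeFinset.card = m * G'.edgeFinset.card := by
    have h1 := G.sum_degrees_eq_twice_card_edges
    have h2 := G'.sum_degrees_eq_twice_card_edges
    have h3 : ∑ x, G.degree x = m * ∑ b, G'.degree b := by
      rw [← Finset.sum_fiberwise (s := Finset.univ) (g := f), Finset.mul_sum]
      refine Finset.sum_congr rfl fun b _ => ?_
      rw [Finset.sum_congr rfl (g := fun _ => G'.degree b), Finset.sum_const, hfib b,
        smul_eq_mul]
      intro x hx
      rw [hdeg, (Finset.mem_filter.1 hx).2]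
    rw [h1, h2] at h3
    linarith
  -- `m` divides both `#V` and `#V - 1`.
  have hm1 : m = 1 := by
    have h := hG.card_edgeFinset
    rw [hcard, hedge] at h
    exact Nat.dvd_one.1 ((Nat.dvd_add_right (Dvd.intro _ rfl)).1 (h ▸ Dvd.intro _ rfl))
  have hinj : Function.Injective f := by
    intro x y hxy
    refine Finset.card_le_one.1 ((hfib (f y)).trans hm1).le x ?_ y ?_ <;> simp [hxy]
  refine ⟨⟨Equiv.ofBijective f ⟨hinj, hsurj⟩, ?_⟩⟩
  intro x y
  refine ⟨fun h => ?_, fun h => (hf x).mapsTo h⟩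
  obtain ⟨z, hz, hzy⟩ := (hf x).surjOn h
  exact hinj hzy ▸ hz

/-- In a connected graph, a vertex other than `v` is joined to a neighbour of `v` by a walk that
avoids `v`. -/
theorem exists_adj_reachable_deleteIncidenceSet (hG : G.Preconnected) {v w : V} (hw : w ≠ v) :
    ∃ u, G.Adj v u ∧ (G.deleteIncidenceSet v).Reachable u w := by
  obtain ⟨p⟩ := hG w v
  have : ∀ {a b : V} (p : G.Walk a b), a ≠ b →
      ∃ u, G.Adj b u ∧ (G.deleteIncidenceSet b).Reachable u a := by
    intro a b p
    induction p with
    | nil => exact fun h => absurd rfl h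
    | @cons a c b h q ih =>
      intro hab
      by_cases hcb : c = b
      · subst hcb
        exact ⟨a, h.symm, .rfl⟩
      · obtain ⟨u, hu, hr⟩ := ih hcb
        exact ⟨u, hu, hr.trans
          (SimpleGraph.Adj.reachable (SimpleGraph.deleteIncidenceSet_adj.2 ⟨h.symm, hcb, hab⟩))⟩
  exact this p hw

theorem deleteIncidenceSet_le_deleteEdges {u v : V} :
    G.deleteIncidenceSet v ≤ G.deleteEdges {s(v, u)} := by
  intro a b h
  rw [SimpleGraph.deleteIncidenceSet_adj] at h
  rw [SimpleGraph.deleteEdges_adj]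
  refine ⟨h.1, fun h' => ?_⟩
  rcases Sym2.eq_iff.1 (Set.mem_singleton_iff.1 h') with h' | h'
  · exact h.2.1 h'.1
  · exact h.2.2 h'.2

/-- A weighted centroid of a tree: if a set of vertices has fewer than `2 ^ (k + 1)` elements,
then some vertex `v` of the tree leaves fewer than `2 ^ k` of them in each component of `G - v`.

If not, every vertex `v` has a neighbour in whose component of `G - v` there are at least `2 ^ k`
of them. As a tree has more vertices than edges, some edge is chosen from both of its ends, and
its removal leaves at least `2 ^ k` of them on either side. -/
theorem exists_centroid [Fintype V] (hG : G.IsTree) {k : ℕ} (S : Finset V)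
    (hS : S.card < 2 ^ (k + 1)) :
    ∃ v, ∀ c : (G.deleteIncidenceSet v).ConnectedComponent, ∀ T : Finset V,
      (∀ y ∈ T, y ∈ S ∧ y ≠ v ∧ (G.deleteIncidenceSet v).connectedComponentMk y = c) →
        T.card < 2 ^ k := by
  classical
  by_contra! hcon
  have key : ∀ v, ∃ u, G.Adj v u ∧ ∃ T ⊆ S,
      (∀ y ∈ T, (G.deleteIncidenceSet v).Reachable u y) ∧ 2 ^ k ≤ T.card := by
    intro v
    obtain ⟨c, T, hT, hk⟩ := hcon v
    obtain ⟨w, hw⟩ := Finset.card_pos.1 (lt_of_lt_of_le (by positivity) hk)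
    obtain ⟨u, hu, hr⟩ := exists_adj_reachable_deleteIncidenceSet
      hG.connected.preconnected (hT w hw).2.1
    refine ⟨u, hu, T, fun y hy => (hT y hy).1, fun y hy => hr.trans ?_, hk⟩
    exact SimpleGraph.ConnectedComponent.exact ((hT w hw).2.2.trans (hT y hy).2.2.symm)
  choose f hadj T hTS hT hk using key
  obtain ⟨v, -, w, -, hvw, he⟩ := Finset.exists_ne_map_eq_of_card_lt_of_maps_to
    (s := Finset.univ) (t := G.edgeFinset) (f := fun v => s(v, f v))
    (by rw [Finset.card_univ, ← hG.card_edgeFinset]; exact Nat.lt_succ_self _)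
    (fun v _ => by simpa using hadj v)
  rcases Sym2.eq_iff.1 he with ⟨h, -⟩ | ⟨h1, h2⟩
  · exact hvw h
  have hdisj : Disjoint (T v) (T w) := by
    rw [Finset.disjoint_left]
    intro y hyv hyw
    have r1 := (hT v y hyv).mono (deleteIncidenceSet_le_deleteEdges (u := w))
    have r2 := (hT w y hyw).mono (deleteIncidenceSet_le_deleteEdges (u := v))
    rw [h2] at r1
    rw [← h1, Sym2.eq_swap] at r2
    have hb := SimpleGraph.isAcyclic_iff_forall_adj_isBridge.1 hG.isAcyclic (h2 ▸ hadj v)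
    exact SimpleGraph.isBridge_iff.1 hb (r2.trans r1.symm)
  have := Finset.card_le_card (Finset.union_subset (hTS v) (hTS w))
  rw [Finset.card_union_of_disjoint hdisj] at this
  have := hk v
  have := hk w
  rw [pow_succ] at hS
  omega

end Graphs

/-! ### Sequences of nested quantifiers -/

section Words

/-- Words of length at most `r` consisting of a block of existential quantifiers followed by a
block of universal ones. -/
def existsForallWords (r : ℕ) : Set (List Quantifier) :=
  {w | ∃ a b, a + b ≤ r ∧ w = List.replicate a .ex ++ List.replicate b .all}

/-- Words of at most `r` existential quantifiers. -/
def existsWords (r : ℕ) : Set (List Quantifier) :=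
  {w | ∃ a ≤ r, w = List.replicate a .ex}

theorem nil_mem_existsForallWords (r : ℕ) : [] ∈ existsForallWords r :=
  ⟨0, 0, by simp, rfl⟩

theorem existsForallWords_mono {r s : ℕ} (h : r ≤ s) :
    existsForallWords r ⊆ existsForallWords s :=
  fun _ ⟨a, b, hab, hw⟩ => ⟨a, b, hab.trans h, hw⟩

theorem cons_mem_existsForallWords {r : ℕ} {w : List Quantifier} (h : w ∈ existsForallWords r) :
    .ex :: w ∈ existsForallWords (r + 1) := by
  obtain ⟨a, b, hab, rfl⟩ := h
  exact ⟨a + 1, b, by omega, by rw [List.replicate_succ, List.cons_append]⟩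

theorem nil_mem_existsWords (r : ℕ) : [] ∈ existsWords r :=
  ⟨0, by simp, rfl⟩

theorem cons_mem_existsWords {r : ℕ} {w : List Quantifier} (h : w ∈ existsWords r) :
    .ex :: w ∈ existsWords (r + 1) := by
  obtain ⟨a, ha, rfl⟩ := h
  exact ⟨a + 1, by omega, by rw [List.replicate_succ]⟩

theorem alternations_replicate (q : Quantifier) (a : ℕ) :
    alternations (List.replicate a q) = 0 := by
  match a with
  | 0 => rfl
  | 1 => rfl
  | a + 2 =>
    have := alternations_replicate q (a + 1)
    rw [List.replicate_succ] at this
    simp [List.replicate_succ, alternations, this]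

theorem alternations_replicate_append_replicate_le (p q : Quantifier) (a b : ℕ) :
    alternations (List.replicate a p ++ List.replicate b q) ≤ 1 := by
  match a with
  | 0 => simp [alternations_replicate]
  | 1 =>
    match b with
    | 0 => simp [alternations]
    | b + 1 =>
      have := alternations_replicate q (b + 1)
      rw [List.replicate_succ] at this
      simp only [List.replicate_succ, List.replicate_zero, List.cons_append, List.nil_append,
        alternations, this]
      split <;> omega
  | a + 2 =>
    have := alternations_replicate_append_replicate_le p q (a + 1) b
    rw [List.replicate_succ, List.cons_append] at this
    simpa [List.replicate_succ, alternations] using this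

end Words

section Nest

variable {L : Language} {α : Type*} {m : ℕ}

theorem image_dual_image_dual (s : Finset (List Quantifier)) :
    (s.image (List.map Quantifier.dual)).image (List.map Quantifier.dual) = s := by
  have : Quantifier.dual ∘ Quantifier.dual = id := by
    funext q; cases q <;> rfl
  rw [Finset.image_image, List.map_comp_map, this, List.map_id_fun, Finset.image_id]

theorem nest_not (φ : L.BoundedFormula α m) :
    nest φ.not = (nest φ).image (List.map Quantifier.dual) ∪ {[]} := rfl

theorem nest_inf (φ ψ : L.BoundedFormula α m) :
    nest (φ ⊓ ψ) = nest φ ∪ nest ψ ∪ {[]} := by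
  change nest (φ.imp ψ.not).not = _
  rw [nest_not, nest, nest_not, Finset.image_union, Finset.image_union, image_dual_image_dual,
    image_dual_image_dual]
  simp [Finset.union_assoc]

theorem nest_sup (φ ψ : L.BoundedFormula α m) :
    nest (φ ⊔ ψ) = nest φ ∪ nest ψ ∪ {[]} := by
  change nest (φ.not.imp ψ) = _
  rw [nest, nest_not, Finset.image_union, image_dual_image_dual]
  ext; simp

theorem nest_ex (φ : L.BoundedFormula α (m + 1)) :
    nest φ.ex = (nest φ).image (List.cons .ex) ∪ {[.ex], []} := by
  change nest φ.not.all.not = _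
  rw [nest_not, nest, nest_not, Finset.image_union, Finset.image_union, Finset.image_image,
    Finset.image_image]
  have : (List.map Quantifier.dual ∘ List.cons Quantifier.all) ∘ List.map Quantifier.dual =
      List.cons .ex := by
    funext w
    have : Quantifier.dual ∘ Quantifier.dual = id := by
      funext q; cases q <;> rfl
    simp [this, Quantifier.dual]
  rw [this]
  simp [Quantifier.dual]

/-- Finite conjunctions do not leave a set of words that contains the empty word. -/
theorem nest_iInf_subset {ι : Type*} [Finite ι] {φ : ι → L.BoundedFormula α m}
    {W : Set (List Quantifier)} (hW : [] ∈ W) (h : ∀ i, ∀ w ∈ nest (φ i), w ∈ W) :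
    ∀ w ∈ nest (BoundedFormula.iInf φ), w ∈ W := by
  change ∀ w ∈ nest (((@Finset.univ ι (Fintype.ofFinite ι)).toList.map φ).foldr (· ⊓ ·) ⊤),
    w ∈ W
  generalize (@Finset.univ ι (Fintype.ofFinite ι)).toList = l
  induction l with
  | nil =>
    intro w hw
    have : w = [] := by simpa [nest_not, Top.top, nest] using hw
    exact this ▸ hW
  | cons i l ih =>
    intro w hw
    rw [List.map_cons, List.foldr_cons, nest_inf] at hw
    simp only [Finset.mem_union, Finset.mem_singleton] at hw
    rcases hw with (hw | hw) | rfl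
    exacts [h i w hw, ih w hw, hW]

/-- Finite disjunctions do not leave a set of words that contains the empty word. -/
theorem nest_iSup_subset {ι : Type*} [Finite ι] {φ : ι → L.BoundedFormula α m}
    {W : Set (List Quantifier)} (hW : [] ∈ W) (h : ∀ i, ∀ w ∈ nest (φ i), w ∈ W) :
    ∀ w ∈ nest (BoundedFormula.iSup φ), w ∈ W := by
  change ∀ w ∈ nest (((@Finset.univ ι (Fintype.ofFinite ι)).toList.map φ).foldr (· ⊔ ·) ⊥),
    w ∈ W
  generalize (@Finset.univ ι (Fintype.ofFinite ι)).toList = l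
  induction l with
  | nil =>
    intro w hw
    have : w = [] := by simpa [Bot.bot, nest] using hw
    exact this ▸ hW
  | cons i l ih =>
    intro w hw
    rw [List.map_cons, List.foldr_cons, nest_sup] at hw
    simp only [Finset.mem_union, Finset.mem_singleton] at hw
    rcases hw with (hw | hw) | rfl
    exacts [h i w hw, ih w hw, hW]

end Nest

/-! ### Formulas over graphs -/

section Formulas

variable {V' : Type*} {m : ℕ}

/-- Truth of a formula in a graph under an assignment of vertices to its variables. -/
def HoldsAt (φ : Language.graph.BoundedFormula Empty m) (G' : SimpleGraph V') (x : Fin m → V') :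
    Prop :=
  @BoundedFormula.Realize Language.graph V' G'.structure Empty m φ default x

/-- The formula saying that the `i`-th and the `j`-th variable are adjacent. -/
def adjFormula (i j : Fin m) : Language.graph.BoundedFormula Empty m :=
  adj.boundedFormula₂ (Term.var (.inr i)) (Term.var (.inr j))

/-- The formula saying that the `i`-th and the `j`-th variable are equal. -/
def eqFormula (i j : Fin m) : Language.graph.BoundedFormula Empty m :=
  Term.bdEqual (Term.var (.inr i)) (Term.var (.inr j))

variable {G' : SimpleGraph V'} {x : Fin m → V'}

theorem holdsAt_adj {i j : Fin m} : HoldsAt (adjFormula i j) G' x ↔ G'.Adj (x i) (x j) := by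
  let := G'.structure
  exact BoundedFormula.realize_rel₂

theorem holdsAt_eq {i j : Fin m} : HoldsAt (eqFormula i j) G' x ↔ x i = x j :=
  Iff.rfl

theorem holdsAt_not {φ : Language.graph.BoundedFormula Empty m} :
    HoldsAt φ.not G' x ↔ ¬ HoldsAt φ G' x :=
  Iff.rfl

theorem holdsAt_imp {φ ψ : Language.graph.BoundedFormula Empty m} :
    HoldsAt (φ.imp ψ) G' x ↔ (HoldsAt φ G' x → HoldsAt ψ G' x) :=
  Iff.rfl

theorem holdsAt_inf {φ ψ : Language.graph.BoundedFormula Empty m} :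
    HoldsAt (φ ⊓ ψ) G' x ↔ HoldsAt φ G' x ∧ HoldsAt ψ G' x := by
  let := G'.structure
  exact BoundedFormula.realize_inf

theorem holdsAt_sup {φ ψ : Language.graph.BoundedFormula Empty m} :
    HoldsAt (φ ⊔ ψ) G' x ↔ HoldsAt φ G' x ∨ HoldsAt ψ G' x := by
  let := G'.structure
  exact BoundedFormula.realize_sup

theorem holdsAt_all {φ : Language.graph.BoundedFormula Empty (m + 1)} :
    HoldsAt φ.all G' x ↔ ∀ a, HoldsAt φ G' (Fin.snoc x a) :=
  Iff.rfl

theorem holdsAt_ex {φ : Language.graph.BoundedFormula Empty (m + 1)} :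
    HoldsAt φ.ex G' x ↔ ∃ a, HoldsAt φ G' (Fin.snoc x a) := by
  let := G'.structure
  exact BoundedFormula.realize_ex

theorem holdsAt_iInf {ι : Type*} [Finite ι] {φ : ι → Language.graph.BoundedFormula Empty m} :
    HoldsAt (BoundedFormula.iInf φ) G' x ↔ ∀ i, HoldsAt (φ i) G' x := by
  let := G'.structure
  exact BoundedFormula.realize_iInf

theorem holdsAt_iSup {ι : Type*} [Finite ι] {φ : ι → Language.graph.BoundedFormula Empty m} :
    HoldsAt (BoundedFormula.iSup φ) G' x ↔ ∃ i, HoldsAt (φ i) G' x := by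
  let := G'.structure
  exact BoundedFormula.realize_iSup

theorem nest_adjFormula (i j : Fin m) : nest (adjFormula i j) = {[]} := rfl

theorem nest_eqFormula (i j : Fin m) : nest (eqFormula i j) = {[]} := rfl

end Formulas

/-! ### Connectedness with logarithmic quantifier rank -/

section Connectedness

variable {V' : Type*} {G' : SimpleGraph V'}

/-- Two vertices are joined by a walk of length at most `l`. -/
def JoinedWithin (G' : SimpleGraph V') (l : ℕ) (a b : V') : Prop :=
  ∃ p : G'.Walk a b, p.length ≤ l

theorem joinedWithin_one {a b : V'} : JoinedWithin G' 1 a b ↔ a = b ∨ G'.Adj a b := by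
  constructor
  · rintro ⟨p, hp⟩
    rcases Nat.le_one_iff_eq_zero_or_eq_one.1 hp with h | h
    · exact .inl (SimpleGraph.Walk.eq_of_length_eq_zero h)
    · exact .inr (SimpleGraph.Walk.adj_of_length_eq_one h)
  · rintro (rfl | h)
    · exact ⟨.nil, by simp⟩
    · exact ⟨h.toWalk, by simp⟩

theorem joinedWithin_add_self {l : ℕ} {a b : V'} :
    JoinedWithin G' (l + l) a b ↔ ∃ c, JoinedWithin G' l a c ∧ JoinedWithin G' l c b := by
  constructor
  · rintro ⟨p, hp⟩
    refine ⟨p.getVert l, ⟨p.take l, ?_⟩, ⟨p.drop l, ?_⟩⟩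
    · rw [SimpleGraph.Walk.take_length]; exact min_le_left _ _
    · rw [SimpleGraph.Walk.drop_length]; omega
  · rintro ⟨c, ⟨p, hp⟩, ⟨q, hq⟩⟩
    exact ⟨p.append q, by rw [SimpleGraph.Walk.length_append]; omega⟩

/-- The formula saying that there is a walk of length at most `2 ^ k` between the `i`-th and the
`j`-th variable; it guesses the midpoint. -/
def walkFormula : ℕ → ∀ {m : ℕ}, Fin m → Fin m → Language.graph.BoundedFormula Empty m
  | 0, _, i, j => eqFormula i j ⊔ adjFormula i j
  | k + 1, m, i, j =>
    (walkFormula k i.castSucc (Fin.last m) ⊓ walkFormula k (Fin.last m) j.castSucc).ex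

theorem nest_walkFormula (k : ℕ) {m : ℕ} (i j : Fin m) :
    ∀ w ∈ nest (walkFormula k i j), w ∈ existsWords k := by
  induction k generalizing m with
  | zero =>
    intro w hw
    simp only [walkFormula, nest_sup, nest_eqFormula, nest_adjFormula, Finset.union_self,
      Finset.mem_singleton] at hw
    exact hw ▸ nil_mem_existsWords 0
  | succ k ih =>
    intro w hw
    simp only [walkFormula, nest_ex, nest_inf, Finset.mem_union, Finset.mem_image,
      Finset.mem_insert, Finset.mem_singleton] at hw
    rcases hw with ⟨w, (hw | hw) | rfl, rfl⟩ | rfl | rfl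
    · exact cons_mem_existsWords (ih _ _ _ hw)
    · exact cons_mem_existsWords (ih _ _ _ hw)
    · exact cons_mem_existsWords (nil_mem_existsWords k)
    · exact cons_mem_existsWords (nil_mem_existsWords k)
    · exact nil_mem_existsWords _

theorem holdsAt_walkFormula {k m : ℕ} {i j : Fin m} {x : Fin m → V'} :
    HoldsAt (walkFormula k i j) G' x ↔ JoinedWithin G' (2 ^ k) (x i) (x j) := by
  induction k generalizing m with
  | zero => rw [walkFormula, holdsAt_sup, holdsAt_eq, holdsAt_adj, pow_zero, joinedWithin_one]
  | succ k ih =>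
    rw [walkFormula, holdsAt_ex, pow_succ, mul_two, joinedWithin_add_self]
    simp only [holdsAt_inf, ih, Fin.snoc_castSucc, Fin.snoc_last]

/-- The sentence saying that any two vertices are joined by a walk of length at most `2 ^ k`. -/
def connectedSentence (k : ℕ) : Language.graph.Sentence :=
  (walkFormula k (0 : Fin 2) 1).all.all

theorem nest_connectedSentence (k : ℕ) : ∀ w ∈ nest (connectedSentence k),
    ∃ a ≤ k, w = List.replicate 2 .all ++ List.replicate a .ex := by
  intro w hw
  simp only [connectedSentence, nest, Finset.mem_image] at hw
  obtain ⟨_, ⟨w, hw, rfl⟩, rfl⟩ := hw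
  obtain ⟨a, ha, rfl⟩ := nest_walkFormula k _ _ w hw
  exact ⟨a, ha, rfl⟩

theorem holds_connectedSentence {k : ℕ} : Holds (connectedSentence k) G' ↔
    ∀ a b, JoinedWithin G' (2 ^ k) a b := by
  change (∀ a b, HoldsAt (walkFormula k (0 : Fin 2) 1) G' (Fin.snoc (Fin.snoc default a) b)) ↔ _
  simp only [holdsAt_walkFormula]
  rfl

end Connectedness

/-! ### Properties of vertex maps definable by `∃*∀*` formulas -/

section Definable

variable {V : Type u}

/-- A property of maps from `V` to the vertices of a graph is definable with quantifier rank `r`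
if, whenever finitely many variables are designated to hold the values of the map, it is expressed
by a formula all of whose sequences of nested quantifiers have the form `∃*∀*` and length at
most `r`. -/
def Definable (r : ℕ) (P : ∀ ⦃V' : Type u⦄, SimpleGraph V' → (V → V') → Prop) : Prop :=
  ∀ (m : ℕ) (σ : V → Fin m), ∃ φ : Language.graph.BoundedFormula Empty m,
    (∀ w ∈ nest φ, w ∈ existsForallWords r) ∧
      ∀ (V' : Type u) (G' : SimpleGraph V') (x : Fin m → V'), HoldsAt φ G' x ↔ P G' (x ∘ σ)

variable {r : ℕ} {P Q : ∀ ⦃V' : Type u⦄, SimpleGraph V' → (V → V') → Prop}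

theorem Definable.mono {s : ℕ} (hP : Definable r P) (h : r ≤ s) : Definable s P := fun m σ =>
  let ⟨φ, h1, h2⟩ := hP m σ
  ⟨φ, fun w hw => existsForallWords_mono h (h1 w hw), h2⟩

theorem Definable.congr (hP : Definable r P)
    (h : ∀ (V' : Type u) (G' : SimpleGraph V') (f : V → V'), P G' f ↔ Q G' f) :
    Definable r Q := fun m σ =>
  let ⟨φ, h1, h2⟩ := hP m σ
  ⟨φ, h1, fun V' G' x => (h2 V' G' x).trans (h V' G' _)⟩

theorem Definable.forall {ι : Type*} [Finite ι]
    {P : ι → ∀ ⦃V' : Type u⦄, SimpleGraph V' → (V → V') → Prop} (hP : ∀ i, Definable r (P i)) :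
    Definable r (fun _ G' f => ∀ i, P i G' f) := by
  intro m σ
  choose φ h1 h2 using fun i => hP i m σ
  refine ⟨BoundedFormula.iInf φ, nest_iInf_subset (nil_mem_existsForallWords r) h1,
    fun V' G' x => ?_⟩
  rw [holdsAt_iInf]
  exact forall_congr' fun i => h2 i V' G' x

theorem Definable.and (hP : Definable r P) (hQ : Definable r Q) :
    Definable r (fun _ G' f => P G' f ∧ Q G' f) :=
  (Definable.forall (P := fun b : Bool => bif b then P else Q) (r := r)
    (fun b => by cases b <;> assumption)).congr
    fun V' G' f => by simp [and_comm]

/-- Existential quantification over the value at one vertex. -/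
theorem Definable.exists_update [DecidableEq V] (hP : Definable r P) (v : V) :
    Definable (r + 1) (fun V' G' f => ∃ b : V', P G' (Function.update f v b)) := by
  intro m σ
  obtain ⟨φ, h1, h2⟩ := hP (m + 1) (Function.update (Fin.castSucc ∘ σ) v (Fin.last m))
  refine ⟨φ.ex, fun w hw => ?_, fun V' G' x => ?_⟩
  · simp only [nest_ex, Finset.mem_union, Finset.mem_image, Finset.mem_insert,
      Finset.mem_singleton] at hw
    rcases hw with ⟨w, hw, rfl⟩ | rfl | rfl
    · exact cons_mem_existsForallWords (h1 w hw)
    · exact cons_mem_existsForallWords (nil_mem_existsForallWords r)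
    · exact nil_mem_existsForallWords _
  · rw [holdsAt_ex]
    refine exists_congr fun b => (h2 V' G' _).trans (iff_of_eq (congrArg (P G') ?_))
    funext y
    by_cases hy : y = v
    · subst hy; simp
    · simp [hy]

/-- Existential quantification over the values at a finite set of vertices. -/
theorem Definable.exists_eqOff (hP : Definable r P) (B : Finset V) :
    Definable (r + B.card) (fun V' G' f => ∃ g : V → V', (∀ y ∉ B, g y = f y) ∧ P G' g) := by
  classical
  induction B using Finset.induction_on with
  | empty =>
    refine hP.congr fun V' G' f => ⟨fun h => ⟨f, fun _ _ => rfl, h⟩, ?_⟩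
    rintro ⟨g, hg, h⟩
    rwa [show f = g from funext fun y => (hg y (by simp)).symm]
  | insert v B hv ih =>
    rw [Finset.card_insert_of_notMem hv, ← add_assoc]
    refine (ih.exists_update v).congr fun V' G' f => ⟨?_, ?_⟩
    · rintro ⟨b, g, hg, h⟩
      refine ⟨g, fun y hy => ?_, h⟩
      rw [Finset.mem_insert, not_or] at hy
      rw [hg y hy.2, Function.update_of_ne hy.1]
    · rintro ⟨g, hg, h⟩
      refine ⟨g v, g, fun y hy => ?_, h⟩
      by_cases hyv : y = v
      · subst hyv; simp
      · rw [Function.update_of_ne hyv]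
        exact hg y (by simp [hyv, hy])

/-- Local bijectivity at a vertex of finite degree is definable with a single quantifier, which
says that the image has no further neighbours. -/
theorem definable_locallyBijectiveAt [Finite V] (G : SimpleGraph V) (v : V) :
    Definable 1 (fun _ G' f => LocallyBijectiveAt G G' f v) := by
  intro m σ
  let φ₁ : G.neighborSet v → Language.graph.BoundedFormula Empty m :=
    fun u => adjFormula (σ v) (σ u)
  let φ₂ : {p : G.neighborSet v × G.neighborSet v // p.1 ≠ p.2} →
      Language.graph.BoundedFormula Empty m :=
    fun p => (eqFormula (σ p.1.1) (σ p.1.2)).not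
  let φ₃ : Language.graph.BoundedFormula Empty m :=
    ((adjFormula (σ v).castSucc (Fin.last m)).imp
      (BoundedFormula.iSup fun u : G.neighborSet v => eqFormula (σ u).castSucc (Fin.last m))).all
  have hnil : ([] : List Quantifier) ∈ existsForallWords 1 := nil_mem_existsForallWords 1
  have n₁ : ∀ w ∈ nest (BoundedFormula.iInf φ₁), w ∈ existsForallWords 1 :=
    nest_iInf_subset hnil fun u w hw => by
      rw [nest_adjFormula, Finset.mem_singleton] at hw
      exact hw ▸ hnil
  have n₂ : ∀ w ∈ nest (BoundedFormula.iInf φ₂), w ∈ existsForallWords 1 :=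
    nest_iInf_subset hnil fun u w hw => by
      simp only [φ₂, nest_not, nest_eqFormula, Finset.image_singleton, List.map_nil,
        Finset.union_self, Finset.mem_singleton] at hw
      exact hw ▸ hnil
  have n₃ : ∀ w ∈ nest φ₃, w ∈ existsForallWords 1 := by
    intro w hw
    simp only [φ₃, nest, nest_adjFormula, Finset.image_union, Finset.image_singleton,
      List.map_nil, Finset.mem_union, Finset.mem_singleton, Finset.mem_image] at hw
    have : w = [.all] := by
      rcases hw with rfl | ⟨w, hw, rfl⟩
      · rfl
      · rw [nest_iSup_subset (W := {[]}) rfl (fun u w hw => by simpa [nest_eqFormula] using hw)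
          w hw]
    exact ⟨0, 1, le_rfl, this⟩
  refine ⟨BoundedFormula.iInf φ₁ ⊓ (BoundedFormula.iInf φ₂ ⊓ φ₃), fun w hw => ?_,
    fun V' G' x => ?_⟩
  · simp only [nest_inf, Finset.mem_union, Finset.mem_singleton] at hw
    rcases hw with (hw | (hw | hw) | rfl) | rfl
    exacts [n₁ w hw, n₂ w hw, n₃ w hw, hnil, hnil]
  · simp only [φ₁, φ₂, φ₃, holdsAt_inf, holdsAt_iInf, holdsAt_iSup, holdsAt_not, holdsAt_eq,
      holdsAt_adj, holdsAt_imp, holdsAt_all, Fin.snoc_castSucc, Fin.snoc_last]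
    constructor
    · rintro ⟨h1, h2, h3⟩
      refine ⟨fun u hu => h1 ⟨u, hu⟩, fun u hu w hw huw => ?_, fun b hb => ?_⟩
      · by_contra hne
        exact h2 ⟨(⟨u, hu⟩, ⟨w, hw⟩), fun h => hne (congrArg Subtype.val h)⟩ huw
      · obtain ⟨u, hu⟩ := h3 b hb
        exact ⟨u, u.2, hu⟩
    · rintro ⟨h1, h2, h3⟩
      refine ⟨fun u => h1 u.2, fun p hp => p.2 (Subtype.ext (h2 p.1.1.2 p.1.2.2 hp)),
        fun b hb => ?_⟩
      obtain ⟨u, hu, rfl⟩ := h3 hb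
      exact ⟨⟨u, hu⟩, rfl⟩

end Definable

/-! ### The defining sentence -/

section Cover

variable {V : Type u} [Fintype V] {G : SimpleGraph V} [DecidableRel G.Adj] {d : ℕ}

/-- A partial map that is defined off `U` can be completed to one that is locally bijective on
`S ⊇ U`: this is definable with quantifier rank proportional to the logarithm of `#S`.

The formula quantifies over the values at a centroid `v` and at its neighbours, checks that the map
is locally bijective at `v`, and is continued by a conjunction over the components of `G - v`, each
with fewer than half of `2 ^ (k + 1)` elements of `S`. The conjuncts guess values at disjoint sets
of vertices, so their witnesses fit together; and the rank of a conjunction is a maximum, so each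
level costs only the at most `d + 1` quantifiers at `v` and its neighbours. -/
theorem definable_exists_locallyBijective (hG : G.IsTree) (hd : ∀ v, G.degree v ≤ d) (k : ℕ) :
    ∀ S U : Finset V, U ⊆ S → S.card < 2 ^ k →
      Definable ((d + 1) * k + 1) (fun V' G' f =>
        ∃ g : V → V', (∀ y ∉ U, g y = f y) ∧ ∀ w ∈ S, LocallyBijectiveAt G G' g w) := by
  classical
  induction k with
  | zero =>
    intro S U hU hS
    have hS0 : S = ∅ := Finset.card_eq_zero.1 (by simpa using hS)
    subst hS0
    rw [Finset.subset_empty.1 hU]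
    exact ((Definable.forall (fun w : (∅ : Finset V) =>
      definable_locallyBijectiveAt G w.1)).exists_eqOff ∅).congr fun V' G' f => by simp
  | succ k ih =>
    intro S U hU hS
    obtain ⟨v, hv⟩ := exists_centroid hG S hS
    set H := G.deleteIncidenceSet v with hH
    let B := U.filter fun y => y = v ∨ G.Adj v y
    let S' : H.ConnectedComponent → Finset V :=
      fun c => S.filter fun y => y ≠ v ∧ H.connectedComponentMk y = c
    let U' : H.ConnectedComponent → Finset V :=
      fun c => (U.filter fun y => y ≠ v ∧ H.connectedComponentMk y = c).filter
        fun y => ¬ G.Adj v y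
    have hB : B.card ≤ d + 1 := by
      calc B.card ≤ (insert v (G.neighborFinset v)).card := by
            refine Finset.card_le_card fun y hy => ?_
            simpa using (Finset.mem_filter.1 hy).2
        _ ≤ (G.neighborFinset v).card + 1 := Finset.card_insert_le _ _
        _ ≤ d + 1 := by rw [SimpleGraph.card_neighborFinset_eq_degree]; exact
                          Nat.succ_le_succ (hd v)
    have h₁ : Definable 1 (fun V' G' (f : V → V') =>
        ∀ w : {w // w ∈ S ∧ w = v}, LocallyBijectiveAt G G' f w.1) :=
      Definable.forall fun w => definable_locallyBijectiveAt G w.1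
    have h₂ := Definable.forall fun c => ih (S' c) (U' c)
      (fun y hy => by
        simp only [U', S', Finset.mem_filter] at hy ⊢
        exact ⟨hU hy.1.1, hy.1.2⟩)
      (hv c (S' c) fun y hy => by simpa only [S', Finset.mem_filter] using hy)
    refine ((((h₁.mono (by omega)).and h₂).exists_eqOff B).mono
      (show (d + 1) * k + 1 + B.card ≤ (d + 1) * (k + 1) + 1 by
        rw [Nat.mul_succ]; omega)).congr fun V' G' f => ⟨?_, ?_⟩
    · rintro ⟨g₀, hg₀, hv₀, hc⟩
      choose g hg hgS using hc
      -- The values on the components are glued to those at `v` and its neighbours.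
      let h : V → V' := fun y =>
        if y ∈ U ∧ y ≠ v ∧ ¬ G.Adj v y then g (H.connectedComponentMk y) y else g₀ y
      have h_old : ∀ y, ¬ (y ∈ U ∧ y ≠ v ∧ ¬ G.Adj v y) → h y = g₀ y := fun y hy => if_neg hy
      have hS' : ∀ y, y ≠ v → (y ∈ U → y ∈ S) → ∀ c, (y ∈ S → H.connectedComponentMk y = c) →
          g c y = h y := by
        intro y hyv hyS c hyc
        by_cases hy : y ∈ U ∧ y ≠ v ∧ ¬ G.Adj v y
        · rw [← hyc (hyS hy.1)]
          exact (if_pos hy).symm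
        · rw [h_old y hy]
          refine hg c y fun hy' => hy ?_
          simp only [U', Finset.mem_filter] at hy'
          exact ⟨hy'.1.1, hyv, hy'.2⟩
      refine ⟨h, fun y hy => ?_, fun w hw => ?_⟩
      · rw [h_old y fun h => hy h.1]
        exact hg₀ y fun h => hy (Finset.mem_filter.1 h).1
      · by_cases hwv : w = v
        · refine (hv₀ ⟨w, hw, hwv⟩).congr (h_old w fun h => h.2.1 hwv).symm fun y hy => ?_
          exact (h_old y fun h => h.2.2 (hwv ▸ hy)).symm
        · refine (hgS (H.connectedComponentMk w) w (Finset.mem_filter.2 ⟨hw, hwv, rfl⟩)).congr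
            (hS' w hwv (fun _ => hw) _ fun _ => rfl) fun y hy => ?_
          by_cases hyv : y = v
          · rw [h_old y fun h => h.2.1 hyv]
            refine hg _ y fun hy' => ?_
            simp only [U', Finset.mem_filter] at hy'
            exact hy'.1.2.1 hyv
          · refine hS' y hyv (fun h => hU h) _ fun _ => ?_
            exact SimpleGraph.ConnectedComponent.sound
              (SimpleGraph.deleteIncidenceSet_adj.2 ⟨hy.symm, hyv, hwv⟩).reachable
    · rintro ⟨g, hg, hgS⟩
      refine ⟨fun y => if y ∈ B then g y else f y, fun y hy => if_neg hy, fun w => ?_, fun c => ?_⟩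
      · obtain ⟨w, hw, rfl⟩ := w
        have : ∀ y, y = w ∨ G.Adj w y → g y = if y ∈ B then g y else f y := by
          intro y hy
          by_cases hyU : y ∈ U
          · rw [if_pos (Finset.mem_filter.2 ⟨hyU, hy⟩)]
          · rw [hg y hyU, ite_self]
        exact (hgS w hw).congr (this w (.inl rfl)) fun y hy => this y (.inr hy)
      · refine ⟨fun y => if y ∈ U' c ∨ y ∈ B then g y else f y, fun y hy => by simp [hy],
          fun w hw => ?_⟩
        simp only [S', Finset.mem_filter] at hw
        have : ∀ y, y = w ∨ G.Adj w y → g y = if y ∈ U' c ∨ y ∈ B then g y else f y := by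
          intro y hy
          by_cases hyU : y ∈ U
          · rw [if_pos]
            by_cases hyv : y = v ∨ G.Adj v y
            · exact .inr (Finset.mem_filter.2 ⟨hyU, hyv⟩)
            · rw [not_or] at hyv
              refine .inl ?_
              simp only [U', Finset.mem_filter]
              refine ⟨⟨hyU, hyv.1, ?_⟩, hyv.2⟩
              rcases hy with rfl | hy
              · exact hw.2.2
              · exact (SimpleGraph.ConnectedComponent.sound
                  (SimpleGraph.deleteIncidenceSet_adj.2 ⟨hy.symm, hyv.1, hw.2.1⟩).reachable).trans
                    hw.2.2
          · rw [hg y hyU, ite_self]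
        exact (hgS w hw.1).congr (this w (.inl rfl)) fun y hy => this y (.inr hy)

/-- The existence of a covering map from a finite tree is expressed by an `∃*∀*` sentence of
logarithmic quantifier rank. The additional quantifier provides a variable that holds the values
of the undefined map at the start. -/
theorem exists_coverSentence (hG : G.IsTree) (hd : ∀ v, G.degree v ≤ d) {k : ℕ}
    (hk : Fintype.card V < 2 ^ k) :
    ∃ φ : Language.graph.Sentence, (∀ w ∈ nest φ, w ∈ existsForallWords ((d + 1) * k + 2)) ∧
      ∀ (V' : Type u) (G' : SimpleGraph V'),
        Holds φ G' ↔ Nonempty V' ∧ ∃ f : V → V', ∀ v, LocallyBijectiveAt G G' f v := by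
  obtain ⟨φ, h1, h2⟩ := definable_exists_locallyBijective hG hd k Finset.univ Finset.univ
    (Finset.Subset.refl _) (by rwa [Finset.card_univ]) 1 (fun _ => 0)
  refine ⟨BoundedFormula.ex φ, fun w hw => ?_, fun V' G' => ?_⟩
  · simp only [nest_ex, Finset.mem_union, Finset.mem_image, Finset.mem_insert,
      Finset.mem_singleton] at hw
    rcases hw with ⟨w, hw, rfl⟩ | rfl | rfl
    · exact cons_mem_existsForallWords (h1 w hw)
    · exact cons_mem_existsForallWords (nil_mem_existsForallWords _)
    · exact nil_mem_existsForallWords _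
  · change HoldsAt (BoundedFormula.ex φ) G' default ↔ _
    rw [holdsAt_ex]
    simp only [h2, Finset.mem_univ, not_true_eq_false, false_imp_iff, implies_true, true_and,
      forall_const, exists_const_iff]

/-- A finite tree of maximum degree at most `d` is defined by the sentence saying that the graph
has small diameter and is covered by the tree. -/
theorem exists_defines (hG : G.IsTree) (hd : ∀ v, G.degree v ≤ d) {k : ℕ}
    (hk : Fintype.card V < 2 ^ k) :
    ∃ φ : Language.graph.Sentence, Defines φ G ∧ alternationNumber φ ≤ 1 ∧
      quantifierRank φ ≤ (d + 1) * k + 2 := by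
  obtain ⟨φ, h1, h2⟩ := exists_coverSentence hG hd hk
  have hnest : ∀ w ∈ nest (connectedSentence k ⊓ φ), ∃ p q : Quantifier, ∃ a b : ℕ,
      a + b ≤ (d + 1) * k + 2 ∧ w = List.replicate a p ++ List.replicate b q := by
    intro w hw
    have hw' : w ∈ nest (connectedSentence k) ∪ nest φ ∪ {[]} := nest_inf _ φ ▸ hw
    simp only [Finset.mem_union, Finset.mem_singleton] at hw'
    rcases hw' with (hw | hw) | rfl
    · obtain ⟨a, ha, rfl⟩ := nest_connectedSentence k w hw
      exact ⟨.all, .ex, 2, a, by nlinarith, rfl⟩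
    · obtain ⟨a, b, hab, rfl⟩ := h1 w hw
      exact ⟨.ex, .all, a, b, hab, rfl⟩
    · exact ⟨.ex, .ex, 0, 0, by omega, rfl⟩
  have hholds : ∀ (V' : Type u) (G' : SimpleGraph V'), Holds (connectedSentence k ⊓ φ) G' ↔
      (∀ a b, JoinedWithin G' (2 ^ k) a b) ∧
        Nonempty V' ∧ ∃ f : V → V', ∀ v, LocallyBijectiveAt G G' f v := by
    intro V' G'
    rw [← h2, ← holds_connectedSentence]
    exact holdsAt_inf
  refine ⟨connectedSentence k ⊓ φ, ⟨?_, fun V' G' hiso => ⟨?_, fun h => ?_⟩⟩, ?_, ?_⟩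
  rotate_left 2
  · obtain ⟨hconn, -, f, hf⟩ := (hholds V' G').1 h
    obtain ⟨e⟩ := nonempty_iso_of_locallyBijective hG (fun a b => ⟨(hconn a b).choose⟩) hf
    exact hiso.false e
  · refine Finset.sup_le fun w hw => ?_
    obtain ⟨p, q, a, b, -, rfl⟩ := hnest w hw
    exact alternations_replicate_append_replicate_le p q a b
  · refine Finset.sup_le fun w hw => ?_
    obtain ⟨p, q, a, b, hab, rfl⟩ := hnest w hw
    simpa using hab
  all_goals
    refine (hholds V G).2 ⟨fun a b => ?_, hG.connected.nonempty, id, locallyBijectiveAt_id⟩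
    classical
    obtain ⟨p⟩ := hG.connected.preconnected a b
    exact ⟨p.toPath, (p.toPath.2.length_lt.trans hk).le⟩

end Cover

end GraphDefinability

/-! ### Bounds on the quantifier rank -/

theorem mainTheorem1 (d : ℕ) (hd : 2 ≤ d) :
    (∀ (V : Type u) [Fintype V] (G : SimpleGraph V) [DecidableRel G.Adj],
      G.IsTree → G.maxDegree = d →
        ∃ φ : FirstOrder.Language.graph.Sentence,
          GraphDefinability.Defines φ G ∧
          GraphDefinability.alternationNumber φ ≤ 2 ∧
          (GraphDefinability.quantifierRank φ : ℝ) <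
            (((d : ℝ) + 1) / Real.logb 2 (3 / 2) + 1) * Real.logb 2 (Fintype.card V) + d + 2) ∧
    (∃ C : ℝ, ∀ (V : Type u) [Fintype V] (G : SimpleGraph V) [DecidableRel G.Adj],
      G.IsTree → G.maxDegree ≤ d → 2 ≤ Fintype.card V →
        ∃ r : ℕ, GraphDefinability.definingRank G = r ∧ (r : ℝ) ≤ C * Real.logb 2 (Fintype.card V)) := by
  have key : ∀ (V : Type u) [Fintype V] (G : SimpleGraph V) [DecidableRel G.Adj],
      G.IsTree → G.maxDegree ≤ d → ∃ φ : FirstOrder.Language.graph.Sentence,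
        GraphDefinability.Defines φ G ∧ GraphDefinability.alternationNumber φ ≤ 1 ∧
          (GraphDefinability.quantifierRank φ : ℝ) ≤
            ((d : ℝ) + 1) * (Real.logb 2 (Fintype.card V) + 1) + 2 := by
    intro V _ G _ hG hdeg
    obtain ⟨φ, h1, h2, h3⟩ := GraphDefinability.exists_defines hG
      (fun v => (G.degree_le_maxDegree v).trans hdeg) (Nat.lt_pow_succ_log_self one_lt_two _)
    refine ⟨φ, h1, h2, ?_⟩
    have hlog : (Nat.log 2 (Fintype.card V) : ℝ) ≤ Real.logb 2 (Fintype.card V) :=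
      Real.natLog_le_logb _ _
    calc (GraphDefinability.quantifierRank φ : ℝ)
        ≤ ((d : ℝ) + 1) * (Nat.log 2 (Fintype.card V) + 1) + 2 := by exact_mod_cast h3
      _ ≤ _ := by gcongr
  have hlog1 : ∀ n : ℕ, 2 ≤ n → 1 ≤ Real.logb 2 n := fun n hn => by
    rw [Real.le_logb_iff_rpow_le one_lt_two (by positivity), Real.rpow_one]
    exact_mod_cast hn
  refine ⟨fun V _ G _ hG hdeg => ?_, 2 * (d + 1) + 2, fun V _ G _ hG hdeg hn => ?_⟩
  · obtain ⟨φ, h1, h2, h3⟩ := key V G hG hdeg.le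
    refine ⟨φ, h1, h2.trans one_le_two, h3.trans_lt ?_⟩
    have := hG.connected.nonempty
    have hn : 2 ≤ Fintype.card V := hd.trans (hdeg ▸ G.maxDegree_lt_card_verts.le)
    have hl := hlog1 _ hn
    have hpos : 0 < Real.logb 2 (3 / 2) := Real.logb_pos one_lt_two (by norm_num)
    have hlt : Real.logb 2 (3 / 2) < 1 := by
      rw [Real.logb_lt_iff_lt_rpow one_lt_two (by norm_num), Real.rpow_one]
      norm_num
    have hslope : (d : ℝ) + 1 < (d + 1) / Real.logb 2 (3 / 2) := by
      rw [lt_div_iff₀ hpos]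
      exact mul_lt_of_lt_one_right (by positivity) hlt
    have := mul_lt_mul_of_pos_right hslope (zero_lt_one.trans_le hl)
    -- The remaining difference of constants, `d + 3` against `d + 2`, is absorbed by `log n ≥ 1`.
    linarith
  · obtain ⟨φ, h1, -, h3⟩ := key V G hG hdeg
    have hle : GraphDefinability.definingRank G ≤ GraphDefinability.quantifierRank φ :=
      iInf₂_le φ h1
    obtain ⟨r, hr⟩ := ENat.ne_top_iff_exists.1 (ne_top_of_le_ne_top (ENat.natCast_ne_top _) hle)
    refine ⟨r, hr.symm, ?_⟩
    rw [← hr, Nat.cast_le] at hle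
    have hl := hlog1 _ hn
    have : (r : ℝ) ≤ GraphDefinability.quantifierRank φ := by exact_mod_cast hle
    nlinarith [(Nat.cast_nonneg d : (0 : ℝ) ≤ d)]
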